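/- Consider conditional disclosure of secrets for a binary function $f$ defined on a set $\mathcal I\subseteq\{1,\dots,X\}\times\{1,\dots,Y\}$. Its characteristic bipartite graph has nodes $A_1,\dots,A_X,B_1,\dots,B_Y$ and an edge $\{A_x,B_y\}$ for each $(x,y)\in\mathcal I$, which is called qualified if $f(x,y)=1$ and unqualified if $f(x,y)=0$. Assume that every node lies on at least one unqualified edge. An unqualified path is a sequence of distinct connecting unqualified edges; a qualified edge $e$ that joins two nodes of an unqualified path $P$ is an internal qualified edge in $P$. A connected edge cover for $(e,P)$ is a set $M\ni e$ of qualified edges that is connected (any two nodes of $M$ are joined by a path of edges of $M$) and covers every node of $P$. Let $\rho(e,P)$ be the least number of edges of such an $M$ ($+\infty$ if there is none), and let $\rho=\min_{e,P}\rho(e,P)$ over all internal qualified edges $e$ in unqualified paths $P$ ($+\infty$ if there are none). A linear scheme over a finite field $\mathbb F$ with a secret $S\in\mathbb F^{L}$ and noise $Z\in\mathbb F^{L_Z}$ ($L_Z$ unrestricted) gives each node $v$ a signal $F_vS+H_vZ$ with $F_v\in\mathbb F^{N\times L}$, $H_v\in\mathbb F^{N\times L_Z}$, $\operatorname{rank}H_v=N$,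 $N\ge1$. It is feasible if, for each edge $\{v,u\}$ and all matrices $P_v,P_u$ with $P_vH_v=P_uH_u$ and $\operatorname{rank}P_v=\operatorname{rank}P_u=\dim(\operatorname{rowspan}H_v\cap\operatorname{rowspan}H_u)$, one has $\operatorname{rank}(P_vF_v-P_uF_u)=L$ if the edge is qualified, and $P_vF_v=P_uF_u$ if it is unqualified. Its rate is $L/(2N)$, and the linear capacity is the supremum of the rates of feasible linear schemes over all finite fields. Suppose that in each connected component of the graph of qualified edges, the qualified edges form a path (possibly a single node) or a cycle; the unqualified edges are arbitrary. (i) If $\rho<\infty$, then the linear capacity equals $\dfrac{\rho-1}{2\rho}$. Moreover, for every prime $p\ge 2\rho-2$ there is a feasible linear scheme over $\mathbb F_p$ with $L=\rho-1$ and $N=\rho$, which attains it. (ii) If $\rho=+\infty$ and there is at least one qualified edge, then the linear capacity equals $\dfrac12$ (the value of $\frac{\rho-1}{2\rho}$ at $\rho=+\infty$). -/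

import Mathlib

/-- An instance of conditional disclosure of secrets: a binary function `f`, defined on a set
`dom` of pairs of inputs `(x, y)` (`true` is the value `1`, `false` the value `0`). -/
structure CDSInstance (X Y : ℕ) where
  dom : Set (Fin X × Fin Y)
  f : dom → Bool

namespace CDSInstance

/-- The nodes of the characteristic graph: `Sum.inl x` is `A_x`, and `Sum.inr y` is `B_y`. -/
abbrev Node (X Y : ℕ) : Type := Fin X ⊕ Fin Y

/-- The bipartite graph joining `A_x` and `B_y` whenever `r x y`. -/
def bipartiteGraph {X Y : ℕ} (r : Fin X → Fin Y → Prop) : SimpleGraph (Node X Y) where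
  Adj u v := (∃ x y, r x y ∧ u = Sum.inl x ∧ v = Sum.inr y) ∨
    (∃ x y, r x y ∧ u = Sum.inr y ∧ v = Sum.inl x)
  symm := ⟨by
    rintro u v (⟨x, y, h, hu, hv⟩ | ⟨x, y, h, hu, hv⟩)
    · exact Or.inr ⟨x, y, h, hv, hu⟩
    · exact Or.inl ⟨x, y, h, hv, hu⟩⟩
  loopless := ⟨by
    rintro u (⟨x, y, _, hu, hv⟩ | ⟨x, y, _, hu, hv⟩) <;> rw [hu] at hv <;> cases hv⟩

variable {X Y : ℕ} (G : CDSInstance X Y)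

/-- The graph of the qualified edges `{A_x, B_y}`, `f (x, y) = 1`. -/
def qualified : SimpleGraph (Node X Y) :=
  bipartiteGraph fun x y => ∃ h : (x, y) ∈ G.dom, G.f ⟨(x, y), h⟩ = true

/-- The graph of the unqualified edges `{A_x, B_y}`, `f (x, y) = 0`. -/
def unqualified : SimpleGraph (Node X Y) :=
  bipartiteGraph fun x y => ∃ h : (x, y) ∈ G.dom, G.f ⟨(x, y), h⟩ = false

/-- `e` is an internal qualified edge in the unqualified path `P` (a sequence of distinct
connecting unqualified edges): a qualified edge between two nodes of `P`. -/
def IsInternalQualifiedEdge (e : Sym2 (Node X Y)) {a b : Node X Y}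
    (P : G.unqualified.Walk a b) : Prop :=
  P.IsTrail ∧ e ∈ G.qualified.edgeSet ∧ ∀ v ∈ e, v ∈ P.support

/-- `M` is a connected edge cover for `(e, P)`: a set of qualified edges that contains `e`,
covers every node of `P`, and is connected (any two nodes of `M` are joined by a path of
edges of `M`). -/
def IsConnectedEdgeCover (e : Sym2 (Node X Y)) {a b : Node X Y}
    (P : G.unqualified.Walk a b) (M : Finset (Sym2 (Node X Y))) : Prop :=
  (∀ d ∈ M, d ∈ G.qualified.edgeSet) ∧ e ∈ M ∧ (∀ v ∈ P.support, ∃ d ∈ M, v ∈ d) ∧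
    ∀ u v : Node X Y, (∃ d ∈ M, u ∈ d) → (∃ d ∈ M, v ∈ d) →
      (SimpleGraph.fromEdgeSet (M : Set (Sym2 (Node X Y)))).Reachable u v

/-- `ρ(e, P)`: the least number of edges of a connected edge cover, `⊤` if there is none. -/
noncomputable def coverNumber (e : Sym2 (Node X Y)) {a b : Node X Y}
    (P : G.unqualified.Walk a b) : ℕ∞ :=
  ⨅ (M : Finset (Sym2 (Node X Y))) (_ : G.IsConnectedEdgeCover e P M), (M.card : ℕ∞)

/-- `ρ`: the minimum of `ρ(e, P)` over all internal qualified edges `e` in unqualified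
paths `P`, `⊤` if there are none. -/
noncomputable def rho : ℕ∞ :=
  ⨅ (e : Sym2 (Node X Y)) (a : Node X Y) (b : Node X Y) (P : G.unqualified.Walk a b)
    (_ : G.IsInternalQualifiedEdge e P), G.coverNumber e P

/-- The nodes and the qualified edges of the qualified component `c` are exactly those of the
walk `w`. -/
def IsTracedBy (c : G.qualified.ConnectedComponent) {a b : Node X Y}
    (w : G.qualified.Walk a b) : Prop :=
  (∀ v, v ∈ w.support ↔ v ∈ c.supp) ∧
    ∀ e, e ∈ w.edges ↔ e ∈ G.qualified.edgeSet ∧ ∀ v ∈ e, v ∈ c.supp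

/-- In each qualified component the qualified edges form a path (possibly a single node
without edges) or a cycle. -/
def ComponentsArePathsOrCycles : Prop :=
  ∀ c : G.qualified.ConnectedComponent,
    (∃ (a b : Node X Y) (w : G.qualified.Walk a b), w.IsPath ∧ G.IsTracedBy c w) ∨
    (∃ (a : Node X Y) (w : G.qualified.Walk a a), w.IsCycle ∧ G.IsTracedBy c w)

end CDSInstance

/-- The dimension of the intersection of the row spaces of two matrices. -/
noncomputable def overlapDim {K : Type} [Field K] {N LZ : ℕ}
    (H H' : Matrix (Fin N) (Fin LZ) K) : ℕ :=
  Module.finrank K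
    ((Submodule.span K (Set.range H.row) ⊓ Submodule.span K (Set.range H'.row) :
      Submodule K (Fin LZ → K)))

/-- `P` and `P'` identify the overlap of the row spaces of `H` and `H'`. -/
def IdentifiesOverlap {K : Type} [Field K] {N LZ k : ℕ} (H H' : Matrix (Fin N) (Fin LZ) K)
    (P P' : Matrix (Fin k) (Fin N) K) : Prop :=
  P * H = P' * H' ∧ P.rank = overlapDim H H' ∧ P'.rank = overlapDim H H'

/-- A linear scheme with `L` secret symbols, `N` symbols per signal and `LZ` noise symbols: the
signal of the node `v` is `F v * S + H v * Z`. -/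
structure LinearScheme (K : Type) [Field K] (X Y L N LZ : ℕ) where
  F : CDSInstance.Node X Y → Matrix (Fin N) (Fin L) K
  H : CDSInstance.Node X Y → Matrix (Fin N) (Fin LZ) K

/-- The scheme is feasible for the instance `G`: the noise precoding matrices have full row
rank, and correctness holds on the qualified edges and security on the unqualified ones. -/
def LinearScheme.Feasible {K : Type} [Field K] {X Y L N LZ : ℕ}
    (C : LinearScheme K X Y L N LZ) (G : CDSInstance X Y) : Prop :=
  (∀ v, (C.H v).rank = N) ∧
  (∀ v u, G.qualified.Adj v u → ∀ (k : ℕ) (P P' : Matrix (Fin k) (Fin N) K),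
    IdentifiesOverlap (C.H v) (C.H u) P P' → (P * C.F v - P' * C.F u).rank = L) ∧
  (∀ v u, G.unqualified.Adj v u → ∀ (k : ℕ) (P P' : Matrix (Fin k) (Fin N) K),
    IdentifiesOverlap (C.H v) (C.H u) P P' → P * C.F v = P' * C.F u)

/-- The rate `R` is achievable for `G` by a feasible linear scheme over some finite field. -/
def CDSInstance.LinearlyAchievable {X Y : ℕ} (G : CDSInstance X Y) (R : ℝ) : Prop :=
  ∃ (K : Type) (_ : Field K) (_ : Finite K) (L N LZ : ℕ) (C : LinearScheme K X Y L N LZ),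
    0 < N ∧ C.Feasible G ∧ R ≤ (L : ℝ) / (2 * (N : ℝ))

/-- `c` is the linear capacity of `G`: the supremum of the linearly achievable rates. -/
def CDSInstance.IsLinearCapacity {X Y : ℕ} (G : CDSInstance X Y) (c : ℝ) : Prop :=
  IsLUB {R : ℝ | G.LinearlyAchievable R} c

/-!
For a feasible scheme let `W v` be the row space of `H v`. Since the rows of `H v` are independent,
there is a linear map `φ v` from the noise to the secrets carrying each combination of the rows of
`H v` to the same combination of the rows of `F v`. Feasibility says that `φ v` and `φ u` agree on
`W v ⊓ W u` along an unqualified edge, and that `φ v - φ u` maps `W v ⊓ W u` onto the space of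
secrets along a qualified one (`LinearScheme.Feasible.exists_maps`).

*Upper bound.* Let `M` be a connected edge cover with `ρ` edges for a qualified edge `e = {x, y}`
internal to an unqualified path `P`. Two adjacent nodes of `M` share at least `L` of their `N` noise
dimensions. Growing `M` edge by edge from `e`, each further edge costs at most `N - L` dimensions,
so the noise common to all nodes of `M` has codimension at most `(ρ - 1) (N - L)` in `W x ⊓ W y`.
On that common noise all `φ v` with `v` on `P` agree, so it lies in the kernel of `φ x - φ y`,
which has codimension `L` in `W x ⊓ W y`. Hence `L ≤ (ρ - 1) (N - L)`
(`IsConnectedEdgeCover.secret_le`).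

*Scheme.* Different qualified components receive independent noise, so an edge between two of them
imposes nothing, and each component can be treated alone (`exists_feasible_of_hasDesign`). Put
`d = ρ - 1`. On a path, or on a cycle of more than `ρ` nodes, the node at position `i` sees the
noise symbols `i, …, i + d`, so that neighbours share `d` symbols and the symbol `k` is seen by `ρ`
consecutive nodes only. A chain of `ρ - 1` qualified edges is too short to cover an unqualified path
joining the ends of one of them (`not_joined_in_arc`). So the connected components of the
unqualified graph induced on the nodes seeing the symbol `k` separate neighbours, and can be given
distinct scalars: along the symbol `k`, the secret reaches a node as its scalar times a vector
`u k`. Neighbours then differ by nonzero multiples of `d` consecutive vectors `u k`, which form a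
basis if the `u k` are points of the moment curve with any `d` cyclically consecutive ones distinct.
Fewer than `2 d` points suffice for this (`cyclicLabel`), which is where `2 ρ - 2 ≤ p` is used. On a
cycle of at most `ρ` nodes, or on any component when `ρ = ⊤`, no qualified edge is internal to an
unqualified path of the component, and all nodes of the component can share the same noise
(`hasDesign_of_not_joined`).
-/

/-! ### Noise spaces of a linear scheme -/

namespace LinearScheme

variable {K : Type} [Field K] {X Y L N LZ : ℕ}

/-- The row space of the noise precoding matrix of the node `v`. -/
def noiseSpace (C : LinearScheme K X Y L N LZ) (v : CDSInstance.Node X Y) :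
    Submodule K (Fin LZ → K) :=
  Submodule.span K (Set.range (C.H v).row)

theorem mem_noiseSpace (C : LinearScheme K X Y L N LZ) (v : CDSInstance.Node X Y)
    (w : Fin LZ → K) : w ∈ C.noiseSpace v ↔ ∃ x, Matrix.vecMul x (C.H v) = w := by
  rw [noiseSpace, ← range_vecMulLinear]
  rfl

theorem linearIndependent_row_of_rank {m n : ℕ} {H : Matrix (Fin m) (Fin n) K} (h : H.rank = m) :
    LinearIndependent K H.row := by
  rw [linearIndependent_iff_card_eq_finrank_span, Set.finrank, ← Matrix.rank_eq_finrank_span_row, h,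
    Fintype.card_fin]

theorem rank_of_linearIndependent_row {m n : ℕ} {H : Matrix (Fin m) (Fin n) K}
    (h : LinearIndependent K H.row) : H.rank = m := by
  rw [linearIndependent_iff_card_eq_finrank_span, Set.finrank, ← Matrix.rank_eq_finrank_span_row,
    Fintype.card_fin] at h
  exact h.symm

/-- The secret precoding of the node `v`, seen as a linear function of the noise: as the rows of
`H v` are independent, there is a linear map sending each combination of them to the same
combination of the rows of `F v`. It matters only on `noiseSpace v`, but it is taken on the whole
space so that different nodes can be compared. -/
theorem exists_secretMap (C : LinearScheme K X Y L N LZ) (v : CDSInstance.Node X Y)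
    (h : (C.H v).rank = N) :
    ∃ φ : (Fin LZ → K) →ₗ[K] (Fin L → K),
      ∀ x, φ (Matrix.vecMul x (C.H v)) = Matrix.vecMul x (C.F v) := by
  have hinj : LinearMap.ker (C.H v).vecMulLinear = ⊥ :=
    LinearMap.ker_eq_bot.2
      (Matrix.vecMul_injective_iff.2 (linearIndependent_row_of_rank h))
  obtain ⟨ψ, hψ⟩ := LinearMap.exists_leftInverse_of_injective _ hinj
  refine ⟨(C.F v).vecMulLinear ∘ₗ ψ, fun x => ?_⟩
  have : ψ (Matrix.vecMul x (C.H v)) = x := LinearMap.congr_fun hψ x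
  simp [this]

/-- Matrices identifying the overlap of two noise spaces, read off from a basis of the
overlap. -/
theorem exists_identifiesOverlap (C : LinearScheme K X Y L N LZ) (v u : CDSInstance.Node X Y) :
    ∃ (k : ℕ) (P P' : Matrix (Fin k) (Fin N) K)
      (b : Module.Basis (Fin k) K ((C.noiseSpace v ⊓ C.noiseSpace u : Submodule K _))),
      IdentifiesOverlap (C.H v) (C.H u) P P' ∧
      (∀ i, Matrix.vecMul (P i) (C.H v) = b i) ∧ ∀ i, Matrix.vecMul (P' i) (C.H u) = b i := by
  let b := Module.finBasis K (C.noiseSpace v ⊓ C.noiseSpace u : Submodule K _)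
  choose P hP using fun i => (C.mem_noiseSpace v (b i)).1 (b i).2.1
  choose P' hP' using fun i => (C.mem_noiseSpace u (b i)).1 (b i).2.2
  have rank_eq : ∀ (H : Matrix (Fin N) (Fin LZ) K) (Q : Matrix (Fin _) (Fin N) K),
      (∀ i, Matrix.vecMul (Q i) H = b i) → Q.rank = overlapDim (C.H v) (C.H u) := by
    intro H Q hQ
    have hrow : (Q * H).row = fun i => (b i : Fin LZ → K) := by
      funext i
      exact (Matrix.mul_apply_eq_vecMul _ _ _).trans (hQ i)
    have hli : LinearIndependent K (Q * H).row := by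
      rw [hrow]
      exact b.linearIndependent.map' (Submodule.subtype _) (Submodule.ker_subtype _)
    refine le_antisymm (Matrix.rank_le_height Q) ?_
    exact (rank_of_linearIndependent_row hli).ge.trans (Matrix.rank_mul_le_left Q H)
  refine ⟨_, P, P', b, ⟨?_, rank_eq _ _ hP, rank_eq _ _ hP'⟩, hP, hP'⟩
  refine funext fun i => ?_
  exact (Matrix.mul_apply_eq_vecMul _ _ _).trans
    (((hP i).trans (hP' i).symm).trans (Matrix.mul_apply_eq_vecMul _ _ _).symm)

/-- The coordinate-free content of a feasible scheme: an `N`-dimensional noise space `W v` and a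
linear map `φ v` for each node, such that across an overlap the maps agree on unqualified edges and
differ by a surjection onto the secrets on qualified ones. -/
theorem Feasible.exists_maps {C : LinearScheme K X Y L N LZ} {G : CDSInstance X Y}
    (hC : C.Feasible G) :
    ∃ (W : CDSInstance.Node X Y → Submodule K (Fin LZ → K))
      (φ : CDSInstance.Node X Y → (Fin LZ → K) →ₗ[K] (Fin L → K)),
      (∀ v, Module.finrank K (W v) = N) ∧
      (∀ v u, G.qualified.Adj v u →
        Module.finrank K ((W v ⊓ W u).map (φ v - φ u)) = L) ∧
      ∀ v u, G.unqualified.Adj v u → ∀ w ∈ W v ⊓ W u, φ v w = φ u w := by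
  obtain ⟨hH, hq, hu⟩ := hC
  choose φ hφ using fun v => C.exists_secretMap v (hH v)
  refine ⟨C.noiseSpace, φ, fun v => ?_, fun v u hvu => ?_, fun v u hvu w hw => ?_⟩
  · rw [noiseSpace, ← Matrix.rank_eq_finrank_span_row, hH]
  · obtain ⟨k, P, P', b, hI, hP, hP'⟩ := C.exists_identifiesOverlap v u
    refine Eq.trans ?_ (hq v u hvu k P P' hI)
    rw [Matrix.rank_eq_finrank_span_row]
    have hrow : (P * C.F v - P' * C.F u).row =
        (φ v - φ u) ∘ Submodule.subtype _ ∘ b := by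
      funext i
      change (P * C.F v) i - (P' * C.F u) i = φ v (b i) - φ u (b i)
      rw [Matrix.mul_apply_eq_vecMul, Matrix.mul_apply_eq_vecMul, ← hφ, ← hφ, hP, hP']
    rw [hrow, Set.range_comp, Set.range_comp, Submodule.span_image, Submodule.span_image,
      b.span_eq, Submodule.map_top, Submodule.range_subtype]
  · obtain ⟨k, P, P', b, hI, hP, hP'⟩ := C.exists_identifiesOverlap v u
    have h0 : (φ v - φ u) ∘ₗ Submodule.subtype (C.noiseSpace v ⊓ C.noiseSpace u) = 0 := by
      refine b.ext fun i => ?_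
      change φ v (b i) - φ u (b i) = 0
      have := congrFun (hu v u hvu k P P' hI) i
      rw [Matrix.mul_apply_eq_vecMul, Matrix.mul_apply_eq_vecMul, ← hφ, ← hφ, hP, hP'] at this
      exact sub_eq_zero.2 this
    exact sub_eq_zero.1 (LinearMap.congr_fun h0 ⟨w, hw⟩)

end LinearScheme

/-! ### The upper bound on the rate -/

namespace CDSInstance

variable {X Y : ℕ} {G : CDSInstance X Y}

theorem finrank_map_add_finrank_inf_ker {K V E : Type*} [Field K] [AddCommGroup V] [Module K V]
    [FiniteDimensional K V] [AddCommGroup E] [Module K E] (f : V →ₗ[K] E) (U : Submodule K V) :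
    Module.finrank K (U.map f) + Module.finrank K (U ⊓ LinearMap.ker f : Submodule K V) =
      Module.finrank K U := by
  have h := LinearMap.finrank_range_add_finrank_ker (f.domRestrict U)
  rw [LinearMap.range_domRestrict, LinearMap.ker_domRestrict] at h
  rw [← h, ← Submodule.map_comap_subtype,
    (Submodule.equivMapOfInjective U.subtype U.injective_subtype _).finrank_eq]

/-- A proper nonempty part `T` of a connected edge cover can be enlarged by an edge that touches
it. -/
theorem IsConnectedEdgeCover.exists_touching {e : Sym2 (Node X Y)} {a b : Node X Y}
    {P : G.unqualified.Walk a b} {M T : Finset (Sym2 (Node X Y))}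
    (hM : G.IsConnectedEdgeCover e P M) (hTM : T ⊂ M) (heT : e ∈ T) :
    ∃ x y, s(x, y) ∈ M ∧ s(x, y) ∉ T ∧ ∃ d ∈ T, x ∈ d := by
  by_contra! hno
  obtain ⟨d, hdM, hdT⟩ := Finset.exists_of_ssubset hTM
  have key : ∀ u v, (SimpleGraph.fromEdgeSet (M : Set (Sym2 (Node X Y)))).Reachable u v →
      (∃ d ∈ T, u ∈ d) → ∃ d ∈ T, v ∈ d := by
    rintro u v ⟨w⟩
    induction w with
    | nil => exact id
    | @cons u v' _ h _ ih =>
      rintro ⟨t, htT, hut⟩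
      refine ih ?_
      by_cases hmem : s(u, v') ∈ T
      · exact ⟨_, hmem, Sym2.mem_mk_right _ _⟩
      · exact absurd hut (hno u v' ((SimpleGraph.fromEdgeSet_adj _).1 h).1 hmem t htT)
  induction d with
  | _ x y =>
    induction e with
    | _ x₀ y₀ =>
      obtain ⟨t, htT, hxt⟩ := key x₀ x
        (hM.2.2.2 x₀ x ⟨_, hM.2.1, Sym2.mem_mk_left _ _⟩ ⟨_, hdM, Sym2.mem_mk_left _ _⟩)
        ⟨_, heT, Sym2.mem_mk_left _ _⟩
      exact hno x y hdM hdT t htT hxt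

/-- Each edge of a connected edge cover costs at most `N - L` dimensions of common noise, so the
noise common to all its nodes has codimension at most `(|M| - 1) (N - L)` in the overlap on `e`. -/
theorem IsConnectedEdgeCover.exists_common_noise {K V : Type*} [Field K] [AddCommGroup V]
    [Module K V] [FiniteDimensional K V] {L N : ℕ} {W : Node X Y → Submodule K V}
    (hW : ∀ v, Module.finrank K (W v) = N)
    (hq : ∀ v u, G.qualified.Adj v u → L ≤ Module.finrank K (W v ⊓ W u : Submodule K V))
    {x y a b : Node X Y} {P : G.unqualified.Walk a b} {M : Finset (Sym2 (Node X Y))}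
    (hM : G.IsConnectedEdgeCover s(x, y) P M) :
    ∃ I : Submodule K V, (∀ d ∈ M, ∀ v ∈ d, I ≤ W v) ∧
      Module.finrank K (W x ⊓ W y : Submodule K V) + L * (M.card - 1) ≤
        Module.finrank K I + N * (M.card - 1) := by
  classical
  suffices H : ∀ n, n + 1 ≤ M.card → ∃ T ⊆ M, s(x, y) ∈ T ∧ T.card = n + 1 ∧
      ∃ I : Submodule K V, (∀ d ∈ T, ∀ v ∈ d, I ≤ W v) ∧
        Module.finrank K (W x ⊓ W y : Submodule K V) + L * n ≤ Module.finrank K I + N * n by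
    have hpos : 0 < M.card := Finset.card_pos.2 ⟨_, hM.2.1⟩
    obtain ⟨T, hTM, -, hcard, I, hI, hdim⟩ := H (M.card - 1) (by omega)
    obtain rfl : T = M := Finset.eq_of_subset_of_card_le hTM (by omega)
    exact ⟨I, hI, hdim⟩
  intro n
  induction n with
  | zero =>
    refine fun _ => ⟨{s(x, y)}, by simpa using hM.2.1, by simp, by simp, W x ⊓ W y, ?_, by simp⟩
    intro d hd v hv
    rw [Finset.mem_singleton.1 hd, Sym2.mem_iff] at hv
    rcases hv with rfl | rfl
    exacts [inf_le_left, inf_le_right]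
  | succ n ih =>
    intro hn
    obtain ⟨T, hTM, heT, hcard, I, hI, hdim⟩ := ih (by omega)
    have hss : T ⊂ M := hTM.ssubset_of_ne (by rintro rfl; omega)
    obtain ⟨z, t, hzM, hzT, d, hdT, hzd⟩ := hM.exists_touching hss heT
    refine ⟨insert s(z, t) T, Finset.insert_subset hzM hTM, Finset.mem_insert_of_mem heT,
      by rw [Finset.card_insert_of_notMem hzT, hcard], I ⊓ W t, ?_, ?_⟩
    · intro d' hd' v hv
      rcases Finset.mem_insert.1 hd' with rfl | hd'
      · rcases Sym2.mem_iff.1 hv with rfl | rfl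
        exacts [inf_le_left.trans (hI d hdT _ hzd), inf_le_right]
      · exact inf_le_left.trans (hI d' hd' v hv)
    · have hIz : I ≤ W z := hI d hdT z hzd
      have h1 := Submodule.finrank_sup_add_finrank_inf_eq I (W z ⊓ W t)
      have h2 : Module.finrank K (I ⊔ (W z ⊓ W t) : Submodule K V) ≤ N :=
        (hW z) ▸ Submodule.finrank_mono (sup_le hIz inf_le_left)
      have h3 := hq z t (hM.1 _ hzM)
      rw [← inf_assoc, inf_eq_left.2 hIz] at h1
      rw [mul_add, mul_add]
      omega

theorem eq_of_mem_support {K V E : Type*} [Field K] [AddCommGroup V] [Module K V]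
    [AddCommGroup E] [Module K E] {W : Node X Y → Submodule K V} {φ : Node X Y → V →ₗ[K] E}
    (hu : ∀ v u, G.unqualified.Adj v u → ∀ w ∈ W v ⊓ W u, φ v w = φ u w)
    {a b : Node X Y} (P : G.unqualified.Walk a b) {w : V} (hw : ∀ v ∈ P.support, w ∈ W v) :
    ∀ v ∈ P.support, φ v w = φ a w := by
  induction P with
  | nil => intro v hv; rw [SimpleGraph.Walk.support_nil, List.mem_singleton] at hv; rw [hv]
  | @cons a c b h P ih =>
    have hw' : ∀ v ∈ P.support, w ∈ W v := fun v hv =>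
      hw v (by rw [SimpleGraph.Walk.support_cons]; exact List.mem_cons_of_mem _ hv)
    intro v hv
    rw [SimpleGraph.Walk.support_cons, List.mem_cons] at hv
    rcases hv with rfl | hv
    · rfl
    · rw [ih hw' v hv]
      exact (hu a c h w ⟨hw a (SimpleGraph.Walk.start_mem_support _),
        hw' c P.start_mem_support⟩).symm

/-- Any connected edge cover bounds the rate: the common noise of its nodes lies in the kernel of
the surjection attached to the qualified edge `e`, since the unqualified path makes the two maps
agree there. -/
theorem IsConnectedEdgeCover.secret_le {K : Type} [Field K] {L N LZ : ℕ}
    {C : LinearScheme K X Y L N LZ} (hC : C.Feasible G) {e : Sym2 (Node X Y)} {a b : Node X Y}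
    {P : G.unqualified.Walk a b} {M : Finset (Sym2 (Node X Y))}
    (he : G.IsInternalQualifiedEdge e P) (hM : G.IsConnectedEdgeCover e P M) :
    L * M.card ≤ N * (M.card - 1) := by
  obtain ⟨W, φ, hW, hq, hu⟩ := hC.exists_maps
  induction e with
  | _ x y =>
    have hq' : ∀ v u, G.qualified.Adj v u →
        L ≤ Module.finrank K (W v ⊓ W u : Submodule K (Fin LZ → K)) := fun v u h =>
      (hq v u h).ge.trans (Submodule.finrank_map_le _ _)
    obtain ⟨I, hI, hdim⟩ := hM.exists_common_noise hW hq'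
    have hsupp : ∀ w ∈ I, ∀ v ∈ P.support, w ∈ W v := fun w hw v hv => by
      obtain ⟨d, hd, hvd⟩ := hM.2.2.1 v hv
      exact hI d hd v hvd hw
    have hx := he.2.2 x (Sym2.mem_mk_left _ _)
    have hy := he.2.2 y (Sym2.mem_mk_right _ _)
    have hle : I ≤ (W x ⊓ W y) ⊓ LinearMap.ker (φ x - φ y) := by
      intro w hw
      refine ⟨⟨hsupp w hw x hx, hsupp w hw y hy⟩, LinearMap.mem_ker.2 ?_⟩
      have := eq_of_mem_support hu P (hsupp w hw)
      rw [ LinearMap.sub_apply, this x hx, this y hy, sub_self]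
    have h1 := Submodule.finrank_mono hle
    have h2 := finrank_map_add_finrank_inf_ker (φ x - φ y) (W x ⊓ W y)
    rw [hq x y he.2.1] at h2
    obtain ⟨m, hm⟩ : ∃ m, M.card = m + 1 :=
      Nat.exists_eq_succ_of_ne_zero (Finset.card_pos.2 ⟨_, hM.2.1⟩).ne'
    rw [hm, Nat.add_sub_cancel] at hdim ⊢
    rw [mul_add]
    omega

theorem exists_cover_of_rho_eq {r : ℕ} (h : G.rho = (r : ℕ∞)) :
    ∃ (e : Sym2 (Node X Y)) (a b : Node X Y) (P : G.unqualified.Walk a b)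
      (M : Finset (Sym2 (Node X Y))), G.IsInternalQualifiedEdge e P ∧
      G.IsConnectedEdgeCover e P M ∧ M.card = r := by
  have hlt : G.rho < ((r + 1 : ℕ) : ℕ∞) := by
    rw [h]; exact_mod_cast Nat.lt_succ_self r
  simp only [rho, coverNumber, iInf_lt_iff] at hlt
  obtain ⟨e, a, b, P, he, M, hM, hlt⟩ := hlt
  refine ⟨e, a, b, P, M, he, hM, ?_⟩
  have hge : G.rho ≤ (M.card : ℕ∞) :=
    iInf_le_of_le e <| iInf_le_of_le a <| iInf_le_of_le b <| iInf_le_of_le P <|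
      iInf_le_of_le he <| iInf_le_of_le M <| iInf_le_of_le hM le_rfl
  rw [h] at hge
  have h1 : r ≤ M.card := by exact_mod_cast hge
  have h2 : M.card < r + 1 := by exact_mod_cast hlt
  omega

theorem secret_le_of_adj {K : Type} [Field K] {L N LZ : ℕ} {C : LinearScheme K X Y L N LZ}
    (hC : C.Feasible G) {u v : Node X Y} (h : G.qualified.Adj u v) : L ≤ N := by
  obtain ⟨W, φ, hW, hq, -⟩ := hC.exists_maps
  rw [← hq u v h, ← hW u]
  exact (Submodule.finrank_map_le _ _).trans (Submodule.finrank_mono inf_le_left)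

end CDSInstance

/-! ### Schemes with noise symbols -/

section

variable {K : Type} [Field K] {X Y L N LZ : ℕ}

/-- A scheme in which each node sees the noise symbols chosen by an injective list `σ v` is
feasible as soon as the secret rows attached to the noise symbols common to two adjacent nodes
agree (unqualified edge) or have differences spanning the space of secrets (qualified edge). -/
theorem LinearScheme.feasible_of_noise_symbols {G : CDSInstance X Y}
    {σ : CDSInstance.Node X Y → Fin N → Fin LZ}
    {F : CDSInstance.Node X Y → Matrix (Fin N) (Fin L) K}
    (hσ : ∀ v, Function.Injective (σ v))
    (hu : ∀ v u, G.unqualified.Adj v u → ∀ i j, σ v i = σ u j → F v i = F u j)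
    (hq : ∀ v u, G.qualified.Adj v u →
      Submodule.span K {x | ∃ i j, σ v i = σ u j ∧ x = F v i - F u j} = ⊤) :
    (LinearScheme.mk F fun v => Matrix.of fun i => Pi.single (σ v i) 1 :
      LinearScheme K X Y L N LZ).Feasible G := by
  set H : CDSInstance.Node X Y → Matrix (Fin N) (Fin LZ) K :=
    fun v => Matrix.of fun i => Pi.single (σ v i) 1 with hH
  have hHrow : ∀ v i, (H v).row i = Pi.single (σ v i) 1 := fun v i => rfl
  have hli : ∀ v, LinearIndependent K (H v).row := by
    intro v
    have := (Pi.basisFun K (Fin LZ)).linearIndependent.comp (σ v) (hσ v)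
    convert this using 1
    funext i
    simp [hHrow]
  refine ⟨fun v => rank_of_linearIndependent_row (hli v), ?_, ?_⟩
  · intro v u hvu k P P' hI
    obtain ⟨hPP, hrk, -⟩ := hI
    -- The rows of `P * H v` fill the whole overlap, by dimension.
    have hspan : Submodule.span K (Set.range (P * H v).row) =
        Submodule.span K (Set.range (H v).row) ⊓ Submodule.span K (Set.range (H u).row) := by
      have hle : ∀ (Q : Matrix (Fin k) (Fin N) K) (w : CDSInstance.Node X Y),
          Submodule.span K (Set.range (Q * H w).row) ≤
            Submodule.span K (Set.range (H w).row) := by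
        intro Q w
        rw [Submodule.span_le, ← range_vecMulLinear (H w)]
        rintro _ ⟨i, rfl⟩
        exact ⟨Q i, (Matrix.mul_apply_eq_vecMul Q (H w) i).symm⟩
      refine Submodule.eq_of_le_of_finrank_eq (le_inf (hle P v) (hPP ▸ hle P' u)) ?_
      rw [← Matrix.rank_eq_finrank_span_row]
      refine Eq.trans ?_ hrk
      have hPv : (P * H v).rank = P.rank := by
        refine le_antisymm (Matrix.rank_mul_le_left _ _) ?_
        rw [Matrix.rank_eq_finrank_span_row, Matrix.rank_eq_finrank_span_row,
          ← range_vecMulLinear, ← range_vecMulLinear]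
        have hinj : Function.Injective (H v).vecMulLinear :=
          Matrix.vecMul_injective_iff.2 (hli v)
        have hcomp : (P * H v).vecMulLinear = (H v).vecMulLinear ∘ₗ P.vecMulLinear :=
          LinearMap.ext fun x => (Matrix.vecMul_vecMul x P (H v)).symm
        rw [hcomp, LinearMap.range_comp,
          ← (Submodule.equivMapOfInjective _ hinj _).finrank_eq]
      exact hPv
    have htop : Submodule.span K (Set.range (P * F v - P' * F u).row) = ⊤ := by
      rw [eq_top_iff, ← hq v u hvu, Submodule.span_le]
      rintro _ ⟨i, j, hij, rfl⟩
      have hmem : (Pi.single (σ v i) 1 : Fin LZ → K) ∈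
          Submodule.span K (Set.range (P * H v).row) := by
        rw [hspan]
        exact ⟨Submodule.subset_span ⟨i, rfl⟩, Submodule.subset_span ⟨j, by rw [hHrow, hij]⟩⟩
      rw [← range_vecMulLinear] at hmem
      obtain ⟨x, hx⟩ := hmem
      rw [Matrix.vecMulLinear_apply] at hx
      have hvec : ∀ (w) (Q : Matrix (Fin k) (Fin N) K) (l : Fin N), Q * H w = P * H v →
          σ v i = σ w l → Matrix.vecMul x Q = Pi.single l 1 := by
        intro w Q l hQ hl
        apply Matrix.vecMul_injective_iff.2 (hli w)
        change Matrix.vecMul (Matrix.vecMul x Q) (H w) = Matrix.vecMul (Pi.single l 1) (H w)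
        rw [Matrix.vecMul_vecMul, hQ, hx, Matrix.single_one_vecMul, hHrow, hl]
      rw [← range_vecMulLinear]
      refine ⟨x, ?_⟩
      rw [Matrix.vecMulLinear_apply, Matrix.vecMul_sub, ← Matrix.vecMul_vecMul,
        ← Matrix.vecMul_vecMul, hvec v P i rfl rfl, hvec u P' j hPP.symm hij,
        Matrix.single_one_vecMul, Matrix.single_one_vecMul]
      rfl
    change (P * F v - P' * F u).rank = L
    rw [Matrix.rank_eq_finrank_span_row, htop, finrank_top, Module.finrank_fin_fun]
  · intro v u hvu k P P' hI
    have hPP : P * H v = P' * H u := hI.1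
    change P * F v = P' * F u
    -- One function of the noise symbols gives the secret rows of both nodes.
    obtain ⟨Φ, hΦv, hΦu⟩ : ∃ Φ : Fin LZ → Fin L → K,
        (∀ i, Φ (σ v i) = F v i) ∧ ∀ j, Φ (σ u j) = F u j := by
      refine ⟨Function.extend (σ v) (F v).row (Function.extend (σ u) (F u).row 0),
        fun i => (hσ v).extend_apply _ _ _, fun j => ?_⟩
      by_cases hj : ∃ i, σ v i = σ u j
      · obtain ⟨i, hi⟩ := hj
        rw [← hi, (hσ v).extend_apply]
        exact hu v u hvu i j hi
      · rw [Function.extend_apply' _ _ _ hj, (hσ u).extend_apply]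
        rfl
    have hfac : ∀ w, (∀ i, Φ (σ w i) = F w i) → F w = H w * Matrix.of Φ := by
      intro w hw
      refine funext fun i => ?_
      rw [← hw i, Matrix.mul_apply_eq_vecMul]
      exact ((Matrix.single_one_vecMul (σ w i) (Matrix.of Φ)).symm :)
    rw [hfac v hΦv, hfac u hΦu, ← Matrix.mul_assoc, hPP, Matrix.mul_assoc]

namespace CDSInstance

variable (G : CDSInstance X Y)

/-- A design for the nodes of `Q` with `N` noise symbols per node: out of `n` symbols, the node `v`
sees the symbols `s v i`, and the secret reaches it along the symbol `k` as the multiple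
`c k v • u k` of a fixed vector `u k`. The scalars `c k` agree across unqualified edges inside `Q`
and differ across qualified ones, where moreover the vectors of the common symbols span. -/
def HasDesign (K : Type) [Field K] (L N : ℕ) (Q : Set (Node X Y)) : Prop :=
  ∃ (n : ℕ) (s : Node X Y → Fin N → Fin n) (c : Fin n → Node X Y → K) (u : Fin n → Fin L → K),
    (∀ v ∈ Q, Function.Injective (s v)) ∧
    (∀ v ∈ Q, ∀ v' ∈ Q, G.unqualified.Adj v v' →
      ∀ i j, s v i = s v' j → c (s v i) v = c (s v i) v') ∧
    ∀ v ∈ Q, ∀ v' ∈ Q, G.qualified.Adj v v' →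
      (∀ i j, s v i = s v' j → c (s v i) v ≠ c (s v i) v') ∧
      Submodule.span K (u '' (Set.range (s v) ∩ Set.range (s v'))) = ⊤

variable {G}

/-- Designs for the qualified components combine into a feasible scheme: with independent noise in
different components, edges between them impose nothing. -/
theorem exists_feasible_of_hasDesign
    (h : ∀ q : G.qualified.ConnectedComponent, G.HasDesign K L N q.supp) :
    ∃ (LZ : ℕ) (C : LinearScheme K X Y L N LZ), C.Feasible G := by
  classical
  choose n s c u hinj hun hqu using h
  let cc := G.qualified.connectedComponentMk
  have : Fintype G.qualified.ConnectedComponent := Fintype.ofFinite _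
  let e := Fintype.equivFin (Σ q : G.qualified.ConnectedComponent, Fin (n q))
  let κ : Node X Y → Fin N → Σ q : G.qualified.ConnectedComponent, Fin (n q) :=
    fun v i => ⟨cc v, s (cc v) v i⟩
  have hκ : ∀ v v' i j, κ v i = κ v' j ↔ cc v = cc v' ∧ s (cc v) v i = s (cc v) v' j := by
    intro v v' i j
    have hsig : ∀ (q q' : G.qualified.ConnectedComponent),
        (⟨q, s q v i⟩ : Σ q : G.qualified.ConnectedComponent, Fin (n q)) = ⟨q', s q' v' j⟩ ↔
          q = q' ∧ s q v i = s q v' j := by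
      intro q q'
      constructor
      · intro h
        obtain rfl : q = q' := congrArg Sigma.fst h
        exact ⟨rfl, eq_of_heq (Sigma.mk.inj h).2⟩
      · rintro ⟨rfl, h⟩
        rw [h]
    exact hsig _ _
  refine ⟨_, _, LinearScheme.feasible_of_noise_symbols (LZ := _)
    (σ := fun v i => e (κ v i))
    (F := fun v => Matrix.of fun i =>
      c (cc v) (s (cc v) v i) v • u (cc v) (s (cc v) v i)) ?_ ?_ ?_⟩
  · intro v i j hij
    exact hinj (cc v) v rfl ((hκ v v i j).1 (e.injective hij)).2
  · intro v v' hadj i j hij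
    obtain ⟨hc, hs⟩ := (hκ v v' i j).1 (e.injective hij)
    change c (cc v) (s (cc v) v i) v • u (cc v) (s (cc v) v i) =
      c (cc v') (s (cc v') v' j) v' • u (cc v') (s (cc v') v' j)
    rw [hun (cc v) v rfl v' hc.symm hadj i j hs, ← hc, hs]
  · intro v v' hadj
    have hc : cc v = cc v' := SimpleGraph.ConnectedComponent.sound hadj.reachable
    obtain ⟨hne, hspan⟩ := hqu (cc v) v rfl v' hc.symm hadj
    rw [eq_top_iff, ← hspan, Submodule.span_le]
    rintro _ ⟨k, ⟨⟨i, hi⟩, ⟨j, hj⟩⟩, rfl⟩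
    subst hi
    have h0 := sub_ne_zero.2 (hne i j hj.symm)
    refine (Submodule.smul_mem_iff _ h0).1 (Submodule.subset_span
      ⟨i, j, congrArg e ((hκ v v' i j).2 ⟨hc, hj.symm⟩), ?_⟩)
    change _ = c (cc v) (s (cc v) v i) v • u (cc v) (s (cc v) v i) -
      c (cc v') (s (cc v') v' j) v' • u (cc v') (s (cc v') v' j)
    rw [← hc, hj, sub_smul]

end CDSInstance

end

/-! ### Chains of qualified edges -/

namespace CDSInstance

variable {X Y : ℕ} {G : CDSInstance X Y}

/-- A chain of fewer than `r ≤ ρ` consecutive qualified edges is too short to cover an unqualified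
path that joins the ends of one of them. -/
theorem not_joined_in_arc {r : ℕ} (hr : (r : ℕ∞) ≤ G.rho) {g : ℕ → Node X Y} {a b : ℕ}
    (hab : b < a + r) (hadj : ∀ j, a ≤ j → j < b → G.qualified.Adj (g j) (g (j + 1)))
    {j : ℕ} (haj : a ≤ j) (hjb : j < b) {x y : Node X Y} (he : s(x, y) = s(g j, g (j + 1)))
    (P : G.unqualified.Walk x y) (hP : ∀ v ∈ P.support, ∃ i, a ≤ i ∧ i ≤ b ∧ g i = v) : False := by
  classical
  set M : Finset (Sym2 (Node X Y)) := (Finset.Ico a b).image fun j => s(g j, g (j + 1)) with hMdef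
  have hmemM : ∀ i, a ≤ i → i < b → s(g i, g (i + 1)) ∈ M := fun i h1 h2 =>
    Finset.mem_image.2 ⟨i, Finset.mem_Ico.2 ⟨h1, h2⟩, rfl⟩
  have hcover : ∀ i, a ≤ i → i ≤ b → ∃ d ∈ M, g i ∈ d := by
    intro i h1 h2
    rcases h2.lt_or_eq with h2 | rfl
    · exact ⟨_, hmemM i h1 h2, Sym2.mem_mk_left _ _⟩
    · refine ⟨_, hmemM (i - 1) (by omega) (by omega), ?_⟩
      rw [Nat.sub_add_cancel (by omega)]
      exact Sym2.mem_mk_right _ _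
  have hnodes : ∀ v, (∃ d ∈ M, v ∈ d) → ∃ i, a ≤ i ∧ i ≤ b ∧ g i = v := by
    rintro v ⟨d, hd, hv⟩
    obtain ⟨i, hi, rfl⟩ := Finset.mem_image.1 hd
    rw [Finset.mem_Ico] at hi
    rcases Sym2.mem_iff.1 hv with rfl | rfl
    exacts [⟨i, by omega, by omega, rfl⟩, ⟨i + 1, by omega, by omega, rfl⟩]
  have hreach : ∀ i, a ≤ i → i ≤ b →
      (SimpleGraph.fromEdgeSet (M : Set (Sym2 (Node X Y)))).Reachable (g a) (g i) := by
    intro i h1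
    induction i, h1 using Nat.le_induction with
    | base => exact fun _ => SimpleGraph.Reachable.refl _
    | succ i h1 ih =>
      intro h2
      exact (ih (by omega)).trans (SimpleGraph.Adj.reachable ((SimpleGraph.fromEdgeSet_adj _).2
        ⟨hmemM i h1 (by omega), (hadj i h1 (by omega)).ne⟩))
  have hsub : ∀ v ∈ (P.toPath : G.unqualified.Walk x y).support, v ∈ P.support := fun v hv =>
    SimpleGraph.Walk.support_toPath_subset_support P hv
  have hint : G.IsInternalQualifiedEdge s(x, y) (P.toPath : G.unqualified.Walk x y) := by
    refine ⟨P.toPath.2.isTrail, he ▸ hadj j haj hjb, fun v hv => ?_⟩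
    rcases Sym2.mem_iff.1 hv with rfl | rfl
    exacts [SimpleGraph.Walk.start_mem_support _, SimpleGraph.Walk.end_mem_support _]
  have hM : G.IsConnectedEdgeCover s(x, y) (P.toPath : G.unqualified.Walk x y) M := by
    refine ⟨fun d hd => ?_, he ▸ hmemM j haj hjb, fun v hv => ?_, fun u v hu hv => ?_⟩
    · obtain ⟨i, hi, rfl⟩ := Finset.mem_image.1 hd
      rw [Finset.mem_Ico] at hi
      exact hadj i hi.1 hi.2
    · obtain ⟨i, h1, h2, rfl⟩ := hP v (hsub v hv)
      exact hcover i h1 h2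
    · obtain ⟨i, h1, h2, rfl⟩ := hnodes u hu
      obtain ⟨i', h1', h2', rfl⟩ := hnodes v hv
      exact (hreach i h1 h2).symm.trans (hreach i' h1' h2')
  have hle : G.rho ≤ (M.card : ℕ∞) :=
    iInf_le_of_le _ <| iInf_le_of_le _ <| iInf_le_of_le _ <| iInf_le_of_le _ <|
      iInf_le_of_le hint <| iInf_le_of_le M <| iInf_le_of_le hM le_rfl
  have h1 : r ≤ M.card := by exact_mod_cast hr.trans hle
  have h2 : M.card ≤ b - a := Finset.card_image_le.trans (Nat.card_Ico a b).le
  omega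

/-- At most `p` nodes can be given labels in `ZMod p` that tell apart the connected components of
the unqualified graph induced on these nodes. -/
theorem exists_component_labels {p : ℕ} [NeZero p] (S : Finset (Node X Y)) (hS : S.card ≤ p) :
    ∃ c : Node X Y → ZMod p,
      (∀ u ∈ S, ∀ v ∈ S, G.unqualified.Adj u v → c u = c v) ∧
      ∀ u ∈ S, ∀ v ∈ S, c u = c v →
        ∃ P : G.unqualified.Walk u v, ∀ w ∈ P.support, w ∈ S := by
  classical
  let H := G.unqualified.induce (S : Set (Node X Y))
  have : Fintype H.ConnectedComponent := Fintype.ofFinite _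
  have hcard : Fintype.card H.ConnectedComponent ≤ Fintype.card (ZMod p) := by
    rw [ZMod.card]
    refine (Fintype.card_le_of_surjective H.connectedComponentMk Quot.mk_surjective).trans ?_
    simpa using hS
  obtain ⟨emb⟩ := Function.Embedding.nonempty_of_card_le hcard
  refine ⟨fun v => if h : v ∈ S then emb (H.connectedComponentMk ⟨v, h⟩) else 0, ?_, ?_⟩
  · intro u hu v hv hadj
    simp only [dif_pos hu, dif_pos hv]
    congr 1
    exact SimpleGraph.ConnectedComponent.sound (SimpleGraph.Adj.reachable (G := H) hadj)
  · intro u hu v hv huv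
    simp only [dif_pos hu, dif_pos hv] at huv
    obtain ⟨w⟩ := SimpleGraph.ConnectedComponent.exact (emb.injective huv)
    refine ⟨w.map (SimpleGraph.Embedding.induce (S : Set (Node X Y))).toHom, fun z hz => ?_⟩
    obtain ⟨z', -, rfl⟩ := List.mem_map.1 (SimpleGraph.Walk.support_map _ w ▸ hz)
    exact z'.2

/-! ### Cyclic sequences with independent windows -/

theorem span_range_powers {K : Type*} [Field K] {d : ℕ} {x : Fin d → K}
    (hx : Function.Injective x) :
    Submodule.span K (Set.range fun (t : Fin d) (i : Fin d) => x t ^ (i : ℕ)) = ⊤ := by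
  refine LinearIndependent.span_eq_top_of_card_eq_finrank' ?_ (by simp)
  have h := Matrix.det_vandermonde_ne_zero_iff.2 hx
  exact Matrix.linearIndependent_rows_iff_isUnit.2
    ((Matrix.isUnit_iff_isUnit_det _).2 h.isUnit)

/-- A labelling of the cyclic positions `0, …, m - 1` by fewer than `2 d` labels: the positions
repeat the labels `0, …, d - 1`, except that the `m % d` positions of the incomplete last round get
fresh ones. Positions with equal labels are at cyclic distance at least `d`. -/
def cyclicLabel (d m k : ℕ) : ℕ := k % d + if k < m - m % d then 0 else d

theorem cyclicLabel_lt {d m k : ℕ} (hd : 0 < d) : cyclicLabel d m k < 2 * d := by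
  have := Nat.mod_lt k hd
  unfold cyclicLabel
  split_ifs <;> omega

theorem cyclicLabel_separated {d m a b : ℕ} (hd : 0 < d) (hab : a < b) (hb : b < m)
    (h : cyclicLabel d m a = cyclicLabel d m b) : d ≤ b - a ∧ b - a + d ≤ m := by
  have ha' := Nat.mod_lt a hd
  have hb' := Nat.mod_lt b hd
  have hm' := Nat.mod_lt m hd
  have ea := Nat.div_add_mod a d
  have eb := Nat.div_add_mod b d
  have em := Nat.div_add_mod m d
  unfold cyclicLabel at h
  have hmod : a % d = b % d := by split_ifs at h <;> omega
  have hq : a / d < b / d := by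
    by_contra hle
    have := Nat.mul_le_mul_left d (not_lt.1 hle)
    omega
  have h1 : d * (a / d) + d ≤ d * (b / d) := by
    rw [← Nat.mul_succ]; exact Nat.mul_le_mul_left d hq
  have hbm : b < m - m % d := by
    by_contra hge
    have h2 : m / d ≤ a / d := by
      by_contra hlt
      have := Nat.mul_le_mul_left d (Nat.succ_le_of_lt (not_le.1 hlt))
      rw [Nat.mul_succ] at this
      split_ifs at h <;> omega
    have := Nat.mul_le_mul_left d h2
    omega
  have h3 : b / d < m / d := by
    by_contra hge
    have := Nat.mul_le_mul_left d (not_lt.1 hge)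
    omega
  have h4 : d * (b / d) + d ≤ d * (m / d) := by
    rw [← Nat.mul_succ]; exact Nat.mul_le_mul_left d h3
  omega

theorem cyclicLabel_injective_window {d m i : ℕ} (hdm : d ≤ m) :
    Function.Injective fun t : Fin d => cyclicLabel d m ((i + t) % m) := by
  have key : ∀ t t' : ℕ, t < t' → t' < d →
      cyclicLabel d m ((i + t) % m) ≠ cyclicLabel d m ((i + t') % m) := by
    intro t t' htt ht' heq
    have hm : 0 < m := by omega
    have h1 := Nat.mod_lt (i + t) hm
    have h2 := Nat.mod_lt (i + t') hm
    -- The two positions differ by `t' - t` or by `m - (t' - t)`.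
    have hstep : (i + t') % m = (i + t) % m + (t' - t) ∨
        (i + t') % m + m = (i + t) % m + (t' - t) := by
      have : i + t' = (i + t) + (t' - t) := by omega
      rw [this, Nat.add_mod, Nat.mod_eq_of_lt (show t' - t < m by omega)]
      rcases lt_or_ge ((i + t) % m + (t' - t)) m with h | h
      · left; exact Nat.mod_eq_of_lt h
      · right
        rw [Nat.mod_eq_sub_mod h, Nat.mod_eq_of_lt (by omega)]
        omega
    rcases lt_or_ge ((i + t) % m) ((i + t') % m) with h | h
    · have := cyclicLabel_separated (by omega) h h2 heq
      omega
    · have := cyclicLabel_separated (by omega) (by omega) h1 heq.symm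
      omega
  intro t t' h
  rcases lt_trichotomy (t : ℕ) t' with hlt | heq | hlt
  · exact absurd h (key _ _ hlt t'.2)
  · exact Fin.ext heq
  · exact absurd h.symm (key _ _ hlt t.2)

theorem natCast_zmod_injOn {p a b : ℕ} (ha : a < p) (hb : b < p)
    (h : (a : ZMod p) = b) : a = b := by
  rw [ZMod.natCast_eq_natCast_iff'] at h
  rwa [Nat.mod_eq_of_lt ha, Nat.mod_eq_of_lt hb] at h

/-! ### Designs for paths and cycles -/

/-- The sliding-window design. The nodes of `Q` sit at distinct positions `pos v` on a circle of
`m > d + 1` places, with qualified edges only between neighbours, and the node `v` sees the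
`d + 1` noise symbols `pos v, …, pos v + d`. The symbol `k` is thus seen within a window, which
`hwin` describes as part of a chain of at most `d` qualified edges. -/
theorem hasDesign_of_positions {p d m : ℕ} [Fact p.Prime] {Q : Set (Node X Y)} (hd : 0 < d)
    (hp : 2 * d ≤ p) (hr : ((d + 1 : ℕ) : ℕ∞) ≤ G.rho) (hm : d + 1 < m)
    {pos : Node X Y → ℕ} {g : ℕ → Node X Y} (hpos : ∀ v ∈ Q, pos v < m)
    (hg : ∀ v ∈ Q, g (pos v) = v)
    (hadj : ∀ v ∈ Q, ∀ v' ∈ Q, G.qualified.Adj v v' →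
      pos v' ≡ pos v + 1 [MOD m] ∨ pos v ≡ pos v' + 1 [MOD m])
    (hwin : ∀ k < m, ∃ a b, b < a + (d + 1) ∧
      (∀ j, a ≤ j → j < b → G.qualified.Adj (g j) (g (j + 1))) ∧
      ∀ v ∈ Q, ∀ t < d + 1, (pos v + t) % m = k →
        ∃ j, a ≤ j ∧ j ≤ b ∧ g j = v ∧ j ≡ pos v [MOD m]) :
    G.HasDesign (ZMod p) d (d + 1) Q := by
  classical
  have hm0 : 0 < m := by omega
  let viewers : ℕ → Finset (Node X Y) := fun k =>
    {v | v ∈ Q ∧ ∃ t < d + 1, (pos v + t) % m = k}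
  have hview : ∀ k v, v ∈ viewers k ↔ v ∈ Q ∧ ∃ t < d + 1, (pos v + t) % m = k := fun k v => by
    simp [viewers]
  have hcard : ∀ k, (viewers k).card ≤ p := by
    intro k
    refine le_trans ?_ (show d + 1 ≤ p by omega)
    rw [← Finset.card_range (d + 1)]
    have hex : ∀ v, ∃ t, v ∈ viewers k → t < d + 1 ∧ (pos v + t) % m = k := by
      intro v
      by_cases hv : v ∈ viewers k
      · obtain ⟨-, t, ht⟩ := (hview k v).1 hv
        exact ⟨t, fun _ => ht⟩
      · exact ⟨0, fun h => absurd h hv⟩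
    choose t ht using hex
    refine Finset.card_le_card_of_injOn t (fun v hv => ?_) fun v hv v' hv' h => ?_
    · exact Finset.mem_coe.2 (Finset.mem_range.2 (ht v hv).1)
    · have h1 := (ht v hv).2
      have h2 := (ht v' hv').2
      rw [← h] at h2
      have hvQ := ((hview k v).1 hv).1
      have hvQ' := ((hview k v').1 hv').1
      have h3 : pos v ≡ pos v' [MOD m] := Nat.ModEq.add_right_cancel' (t v) (h1.trans h2.symm)
      have h4 : pos v = pos v' := by
        rwa [Nat.ModEq, Nat.mod_eq_of_lt (hpos v hvQ), Nat.mod_eq_of_lt (hpos v' hvQ')] at h3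
      rw [← hg v hvQ, h4, hg v' hvQ']
  choose c hc1 hc2 using fun k => exists_component_labels (G := G) (viewers k) (hcard k)
  have hmem : ∀ v ∈ Q, ∀ i : Fin (d + 1), v ∈ viewers ((pos v + i) % m) := fun v hv i =>
    (hview _ v).2 ⟨hv, i, i.2, rfl⟩
  -- The separation of the labels, for the endpoints in one of the two orders.
  have hsep : ∀ k < m, ∀ v ∈ viewers k, ∀ v' ∈ viewers k, G.qualified.Adj v v' →
      pos v' ≡ pos v + 1 [MOD m] → c k v ≠ c k v' := by
    intro k hk v hv v' hv' hvv hpp heq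
    obtain ⟨a, b, hab, hchain, hin⟩ := hwin k hk
    have hin' : ∀ z ∈ viewers k, ∃ j, a ≤ j ∧ j ≤ b ∧ g j = z ∧ j ≡ pos z [MOD m] := by
      intro z hz
      obtain ⟨hzQ, t, ht, htk⟩ := (hview k z).1 hz
      exact hin z hzQ t ht htk
    obtain ⟨j, h1, h2, hj, hjm⟩ := hin' v hv
    obtain ⟨j', h1', h2', hj', hjm'⟩ := hin' v' hv'
    obtain ⟨P, hP⟩ := hc2 k v hv v' hv' heq
    have hcong : j' ≡ j + 1 [MOD m] := hjm'.trans (hpp.trans (hjm.symm.add_right 1))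
    have hjj : j' = j + 1 := by
      -- Both indices lie in an interval of length at most `d`, and `d + 1 < m`.
      rcases le_total j' (j + 1) with hle | hle
      · have := (Nat.modEq_iff_dvd' hle).1 hcong
        have := Nat.eq_zero_of_dvd_of_lt this (by omega)
        omega
      · have := (Nat.modEq_iff_dvd' hle).1 hcong.symm
        have := Nat.eq_zero_of_dvd_of_lt this (by omega)
        omega
    refine not_joined_in_arc hr hab hchain h1 (by omega) (x := v) (y := v') ?_ P fun z hz => ?_
    · rw [← hjj, hj, hj']
    · obtain ⟨i, h3, h4, h5, -⟩ := hin' z (hP z hz)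
      exact ⟨i, h3, h4, h5⟩
  -- Neighbours share a run of `d` consecutive symbols.
  have hspan : ∀ v v', pos v' ≡ pos v + 1 [MOD m] →
      Submodule.span (ZMod p) ((fun (k : Fin m) (i : Fin d) =>
        (cyclicLabel d m k : ZMod p) ^ (i : ℕ)) ''
          (Set.range (fun t : Fin (d + 1) => (⟨(pos v + t) % m, Nat.mod_lt _ hm0⟩ : Fin m)) ∩
           Set.range (fun t : Fin (d + 1) => (⟨(pos v' + t) % m, Nat.mod_lt _ hm0⟩ : Fin m))))
        = ⊤ := by
    intro v v' hpp
    have hx : Function.Injective fun t : Fin d =>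
        (cyclicLabel d m ((pos v + 1 + t) % m) : ZMod p) := fun t t' h =>
      cyclicLabel_injective_window (i := pos v + 1) (show d ≤ m by omega)
        (natCast_zmod_injOn ((cyclicLabel_lt hd).trans_le hp) ((cyclicLabel_lt hd).trans_le hp) h)
    rw [eq_top_iff, ← span_range_powers hx]
    refine Submodule.span_mono ?_
    rintro _ ⟨t, rfl⟩
    refine ⟨⟨(pos v + 1 + t) % m, Nat.mod_lt _ hm0⟩, ⟨⟨t.succ, ?_⟩, ⟨t.castSucc, ?_⟩⟩, rfl⟩
    · simp only [Fin.val_succ, Fin.mk.injEq]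
      congr 1; omega
    · simp only [Fin.val_castSucc, Fin.mk.injEq]
      exact hpp.add_right t
  refine ⟨m, fun v t => ⟨(pos v + t) % m, Nat.mod_lt _ hm0⟩, fun k => c k,
    fun k i => (cyclicLabel d m k : ZMod p) ^ (i : ℕ), ?_, ?_, ?_⟩
  · intro v _ t t' h
    have h1 : (t : ℕ) ≡ t' [MOD m] := Nat.ModEq.add_left_cancel' (pos v) (Fin.mk.inj h)
    rw [Nat.ModEq, Nat.mod_eq_of_lt (by omega), Nat.mod_eq_of_lt (by omega)] at h1
    exact Fin.ext h1
  · intro v hv v' hv' hvv i j hij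
    have hij' : (pos v + i) % m = (pos v' + j) % m := Fin.mk.inj hij
    exact hc1 _ v (hmem v hv i) v' (hij' ▸ hmem v' hv' j) hvv
  · intro v hv v' hv' hvv
    refine ⟨fun i j hij => ?_, ?_⟩
    · have hij' : (pos v + i) % m = (pos v' + j) % m := Fin.mk.inj hij
      have hv1 := hmem v hv i
      have hv2 : v' ∈ viewers ((pos v + i) % m) := hij' ▸ hmem v' hv' j
      rcases hadj v hv v' hv' hvv with h | h
      · exact hsep _ (Nat.mod_lt _ hm0) v hv1 v' hv2 hvv h
      · exact (hsep _ (Nat.mod_lt _ hm0) v' hv2 v hv1 hvv.symm h).symm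
    · rcases hadj v hv v' hv' hvv with h | h
      · exact hspan v v' h
      · rw [Set.inter_comm]
        exact hspan v' v h

end CDSInstance

namespace CDSInstance

variable {X Y : ℕ} {G : CDSInstance X Y}

/-- If no unqualified path within `Q` joins the ends of a qualified edge of `Q`, all nodes of `Q`
can share the same noise. -/
theorem hasDesign_of_not_joined {p L N : ℕ} [Fact p.Prime] {Q : Set (Node X Y)}
    (hcard : Q.ncard ≤ p) {u : Fin N → Fin L → ZMod p}
    (hu : Submodule.span (ZMod p) (Set.range u) = ⊤)
    (hno : ∀ v ∈ Q, ∀ v' ∈ Q, G.qualified.Adj v v' → ∀ P : G.unqualified.Walk v v',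
      ¬ ∀ w ∈ P.support, w ∈ Q) :
    G.HasDesign (ZMod p) L N Q := by
  obtain ⟨c, hc1, hc2⟩ := exists_component_labels (G := G) (p := p) (Set.toFinite Q).toFinset
    (by rwa [← Set.ncard_eq_toFinset_card])
  simp only [Set.Finite.mem_toFinset] at hc1 hc2
  refine ⟨N, fun _ i => i, fun _ => c, u, fun _ _ => Function.injective_id,
    fun v hv v' hv' hvv _ _ _ => hc1 v hv v' hv' hvv, fun v hv v' hv' hvv => ⟨?_, ?_⟩⟩
  · intro _ _ _ heq
    obtain ⟨P, hP⟩ := hc2 v hv v' hv' heq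
    exact hno v hv v' hv' hvv P hP
  · have hid : Set.range (fun i : Fin N => i) = Set.univ := Set.range_id
    rw [hid, Set.inter_self, Set.image_univ, hu]

theorem IsTracedBy.mk_mem_edges {c : G.qualified.ConnectedComponent} {a b : Node X Y}
    {w : G.qualified.Walk a b} (h : G.IsTracedBy c w) {v v' : Node X Y} (hv : v ∈ c.supp)
    (hv' : v' ∈ c.supp) (hadj : G.qualified.Adj v v') :
    ∃ i < w.length, s(v, v') = s(w.getVert i, w.getVert (i + 1)) := by
  have hmem : s(v, v') ∈ w.edges := (h.2 _).2 ⟨hadj, fun z hz => by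
    rcases Sym2.mem_iff.1 hz with rfl | rfl <;> assumption⟩
  obtain ⟨i, hi, he⟩ := (SimpleGraph.Walk.mk_mem_edges_iff_exists w).1 hmem
  exact ⟨i, hi, he.symm⟩

theorem not_joined_of_rho_eq_top (hρ : G.rho = ⊤) {c : G.qualified.ConnectedComponent}
    {a b : Node X Y} {w : G.qualified.Walk a b} (hw : G.IsTracedBy c w) {v v' : Node X Y}
    (hv : v ∈ c.supp) (hv' : v' ∈ c.supp) (hadj : G.qualified.Adj v v')
    (P : G.unqualified.Walk v v') : ¬ ∀ z ∈ P.support, z ∈ c.supp := by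
  intro hP
  obtain ⟨i, hi, he⟩ := hw.mk_mem_edges hv hv' hadj
  refine not_joined_in_arc (r := w.length + 1) (hρ ▸ le_top) (g := w.getVert) (a := 0)
    (b := w.length) (by omega) (fun j _ hj => w.adj_getVert_succ hj) (Nat.zero_le i) hi he P
    fun z hz => ?_
  obtain ⟨j, hj, hjl⟩ :=
    SimpleGraph.Walk.mem_support_iff_exists_getVert.1 ((hw.1 z).2 (hP z hz))
  exact ⟨j, Nat.zero_le j, hjl, hj⟩

/-- Path components carry the sliding-window design, on a circle long enough not to wrap around. -/
theorem hasDesign_of_isPath {p d : ℕ} [Fact p.Prime] (hd : 0 < d) (hp : 2 * d ≤ p)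
    (hr : ((d + 1 : ℕ) : ℕ∞) ≤ G.rho) {c : G.qualified.ConnectedComponent} {a b : Node X Y}
    {w : G.qualified.Walk a b} (hw : w.IsPath) (hc : G.IsTracedBy c w) :
    G.HasDesign (ZMod p) d (d + 1) c.supp := by
  have hex : ∀ v, ∃ i, v ∈ c.supp → w.getVert i = v ∧ i ≤ w.length := by
    intro v
    by_cases hv : v ∈ c.supp
    · obtain ⟨i, hi⟩ := SimpleGraph.Walk.mem_support_iff_exists_getVert.1 ((hc.1 v).2 hv)
      exact ⟨i, fun _ => hi⟩
    · exact ⟨0, fun h => absurd h hv⟩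
  choose pos hpos using hex
  have hinj : ∀ v ∈ c.supp, ∀ i ≤ w.length, w.getVert i = v → pos v = i := fun v hv i hi h =>
    hw.getVert_injOn (hpos v hv).2 hi ((hpos v hv).1.trans h.symm)
  refine hasDesign_of_positions (m := w.length + 1 + (d + 1)) hd hp hr (by omega)
    (pos := pos) (g := w.getVert) (fun v hv => ?_) (fun v hv => (hpos v hv).1) ?_ ?_
  · have := (hpos v hv).2
    omega
  · intro v hv v' hv' hadj
    obtain ⟨i, hi, he⟩ := hc.mk_mem_edges hv hv' hadj
    rcases Sym2.eq_iff.1 he with ⟨h1, h2⟩ | ⟨h1, h2⟩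
    · left
      rw [hinj v hv i hi.le h1.symm, hinj v' hv' (i + 1) hi h2.symm]
    · right
      rw [hinj v hv (i + 1) hi h1.symm, hinj v' hv' i hi.le h2.symm]
  · intro k _
    refine ⟨k - d, min k w.length, by omega,
      fun j _ hj => w.adj_getVert_succ (hj.trans_le (min_le_right _ _)), fun v hv t ht hk => ?_⟩
    have h := hpos v hv
    rw [Nat.mod_eq_of_lt (by omega)] at hk
    exact ⟨pos v, by omega, le_min (by omega) h.2, h.1, Nat.ModEq.refl _⟩

/-- The nodes of a closed walk in cyclic order, indexed periodically. -/
def periodicVert {a : Node X Y} (w : G.qualified.Walk a a) (j : ℕ) : Node X Y :=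
  w.getVert (j % w.length)

theorem periodicVert_of_le {a : Node X Y} {w : G.qualified.Walk a a} {i : ℕ}
    (hi : i ≤ w.length) : periodicVert w i = w.getVert i := by
  unfold periodicVert
  rcases hi.lt_or_eq with hi | rfl
  · rw [Nat.mod_eq_of_lt hi]
  · rw [Nat.mod_self, w.getVert_zero, w.getVert_length]

theorem periodicVert_adj {a : Node X Y} {w : G.qualified.Walk a a} (hw : 0 < w.length) (j : ℕ) :
    G.qualified.Adj (periodicVert w j) (periodicVert w (j + 1)) := by
  have hlt := Nat.mod_lt j hw
  have h1 : periodicVert w (j + 1) = periodicVert w (j % w.length + 1) := by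
    simp [periodicVert, Nat.add_mod]
  rw [h1, periodicVert_of_le (i := j % w.length + 1) hlt]
  exact w.adj_getVert_succ hlt

/-- Cycle components of more than `d + 1` nodes carry the sliding-window design. -/
theorem hasDesign_of_long_cycle {p d : ℕ} [Fact p.Prime] (hd : 0 < d) (hp : 2 * d ≤ p)
    (hr : ((d + 1 : ℕ) : ℕ∞) ≤ G.rho) {c : G.qualified.ConnectedComponent} {a : Node X Y}
    {w : G.qualified.Walk a a} (hw : w.IsCycle) (hc : G.IsTracedBy c w)
    (hlong : d + 1 < w.length) : G.HasDesign (ZMod p) d (d + 1) c.supp := by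
  have hm : 0 < w.length := by omega
  have hex : ∀ v, ∃ i, v ∈ c.supp → w.getVert i = v ∧ i < w.length := by
    intro v
    by_cases hv : v ∈ c.supp
    · obtain ⟨i, hi, hil⟩ := SimpleGraph.Walk.mem_support_iff_exists_getVert.1 ((hc.1 v).2 hv)
      refine ⟨i % w.length, fun _ => ⟨?_, Nat.mod_lt _ hm⟩⟩
      rw [← hi]
      exact periodicVert_of_le hil
    · exact ⟨0, fun h => absurd h hv⟩
  choose pos hpos using hex
  have hinj : ∀ v ∈ c.supp, ∀ i ≤ w.length, w.getVert i = v → pos v = i % w.length := by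
    intro v hv i hi h
    have h1 := hpos v hv
    have h2 := Nat.mod_lt i hm
    refine hw.getVert_injOn' (Nat.le_sub_one_of_lt h1.2) (Nat.le_sub_one_of_lt h2) (h1.1.trans ?_)
    rw [← h]
    exact (periodicVert_of_le hi).symm
  refine hasDesign_of_positions hd hp hr hlong (pos := pos) (g := periodicVert w)
    (fun v hv => (hpos v hv).2)
    (fun v hv => (periodicVert_of_le (hpos v hv).2.le).trans (hpos v hv).1) ?_ ?_
  · have hstep : ∀ i < w.length, ∀ v ∈ c.supp, ∀ v' ∈ c.supp, v = w.getVert i →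
        v' = w.getVert (i + 1) → pos v' ≡ pos v + 1 [MOD w.length] := by
      intro i hi v hv v' hv' h h'
      rw [hinj v hv i hi.le h.symm, hinj v' hv' (i + 1) hi h'.symm]
      exact (Nat.mod_modEq _ _).trans ((Nat.mod_modEq _ _).symm.add_right 1)
    intro v hv v' hv' hadj
    obtain ⟨i, hi, he⟩ := hc.mk_mem_edges hv hv' hadj
    rcases Sym2.eq_iff.1 he with ⟨h1, h2⟩ | ⟨h1, h2⟩
    · exact Or.inl (hstep i hi v hv v' hv' h1 h2)
    · exact Or.inr (hstep i hi v' hv' v hv h2 h1)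
  · intro k hk
    -- Shifted by one turn, so that the window does not run below `0`.
    refine ⟨k + w.length - d, k + w.length, by omega, fun j _ _ => periodicVert_adj hm j,
      fun v hv t ht hkt => ⟨k + w.length - t, by omega, by omega, ?_⟩⟩
    have hmod : k + w.length - t ≡ pos v [MOD w.length] := by
      refine Nat.ModEq.add_right_cancel' t ?_
      rw [Nat.sub_add_cancel (by omega), Nat.ModEq, Nat.add_mod_right, hkt, Nat.mod_eq_of_lt hk]
    refine ⟨?_, hmod⟩
    unfold periodicVert
    rw [hmod, Nat.mod_eq_of_lt (hpos v hv).2, (hpos v hv).1]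

/-- A cycle component of at most `d + 1 ≤ ρ` nodes has no internal qualified edge: removing one
other edge leaves a connected edge cover of all its nodes. Hence its nodes can share their noise. -/
theorem hasDesign_of_short_cycle {p d : ℕ} [Fact p.Prime] (hp : 2 * d ≤ p)
    (hr : ((d + 1 : ℕ) : ℕ∞) ≤ G.rho) {c : G.qualified.ConnectedComponent} {a : Node X Y}
    {w : G.qualified.Walk a a} (hw : w.IsCycle) (hc : G.IsTracedBy c w)
    (hshort : w.length ≤ d + 1) : G.HasDesign (ZMod p) d (d + 1) c.supp := by
  have hm : 3 ≤ w.length := hw.three_le_length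
  have hsupp : ∀ v ∈ c.supp, ∃ i < w.length, periodicVert w i = v := by
    intro v hv
    obtain ⟨i, hi, hil⟩ := SimpleGraph.Walk.mem_support_iff_exists_getVert.1 ((hc.1 v).2 hv)
    refine ⟨i % w.length, Nat.mod_lt _ (by omega), ?_⟩
    rw [← hi, ← periodicVert_of_le hil]
    simp [periodicVert]
  have hcard : c.supp.ncard ≤ p := by
    have hsub : c.supp ⊆ periodicVert w '' (Finset.range w.length : Set ℕ) := fun v hv => by
      obtain ⟨i, hi, h⟩ := hsupp v hv
      exact ⟨i, by simpa using hi, h⟩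
    have h1 := (Set.ncard_le_ncard hsub).trans (Set.ncard_image_le (Finset.finite_toSet _))
    rw [Set.ncard_coe_finset, Finset.card_range] at h1
    omega
  have hx : Function.Injective fun t : Fin d => ((t : ℕ) : ZMod p) := fun t t' h =>
    Fin.ext (natCast_zmod_injOn (by omega) (by omega) h)
  refine hasDesign_of_not_joined hcard
    (u := fun (t : Fin (d + 1)) (i : Fin d) => ((t : ℕ) : ZMod p) ^ (i : ℕ)) ?_ ?_
  · rw [eq_top_iff, ← span_range_powers hx]
    refine Submodule.span_mono ?_
    rintro _ ⟨t, rfl⟩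
    exact ⟨t.castSucc, rfl⟩
  · intro v hv v' hv' hadj P hP
    obtain ⟨i, hi, he⟩ := hc.mk_mem_edges hv hv' hadj
    rw [← periodicVert_of_le hi.le, ← periodicVert_of_le (i := i + 1) hi] at he
    refine not_joined_in_arc hr (g := periodicVert w) (a := i) (b := i + w.length - 1) (by omega)
      (fun j _ _ => periodicVert_adj (by omega) j) le_rfl (by omega) he P fun z hz => ?_
    obtain ⟨j, hj, hjz⟩ := hsupp z (hP z hz)
    rcases le_or_gt i j with hij | hij
    · exact ⟨j, hij, by omega, hjz⟩
    · refine ⟨j + w.length, by omega, by omega, ?_⟩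
      rw [← hjz]
      simp [periodicVert]

theorem exists_feasible_of_le_rho (hpc : G.ComponentsArePathsOrCycles) {p d : ℕ} [Fact p.Prime]
    (hp : 2 * d ≤ p) (hr : ((d + 1 : ℕ) : ℕ∞) ≤ G.rho) :
    ∃ (LZ : ℕ) (C : LinearScheme (ZMod p) X Y d (d + 1) LZ), C.Feasible G := by
  rcases Nat.eq_zero_or_pos d with rfl | hd
  · -- There is no secret, so pure noise will do.
    refine ⟨1, ⟨fun _ => 0, fun _ => 1⟩, fun _ => ?_, fun _ _ _ k P P' _ => ?_,
      fun _ _ _ k P P' _ => ?_⟩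
    · exact (Matrix.rank_one).trans (Fintype.card_fin 1)
    · exact Nat.le_zero.1 (Matrix.rank_le_width _)
    · ext _ l
      exact l.elim0
  · refine exists_feasible_of_hasDesign fun c => ?_
    rcases hpc c with ⟨a, b, w, hw, hc⟩ | ⟨a, w, hw, hc⟩
    · exact hasDesign_of_isPath hd hp hr hw hc
    · rcases le_or_gt w.length (d + 1) with h | h
      · exact hasDesign_of_short_cycle hp hr hw hc h
      · exact hasDesign_of_long_cycle hd hp hr hw hc h

theorem exists_feasible_of_rho_eq_top (hpc : G.ComponentsArePathsOrCycles) (hρ : G.rho = ⊤)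
    {p : ℕ} [Fact p.Prime] (hp : X + Y ≤ p) :
    ∃ (LZ : ℕ) (C : LinearScheme (ZMod p) X Y 1 1 LZ), C.Feasible G := by
  refine exists_feasible_of_hasDesign fun c => ?_
  have hcard : c.supp.ncard ≤ p := by
    refine le_trans (Set.ncard_le_card _) (le_trans (le_of_eq ?_) hp)
    simp
  refine hasDesign_of_not_joined hcard (u := fun _ i => 1 ^ (i : ℕ))
    (span_range_powers (x := fun _ : Fin 1 => 1) (Function.injective_of_subsingleton _)) ?_
  · intro v hv v' hv' hadj P
    rcases hpc c with ⟨a, b, w, -, hc⟩ | ⟨a, w, -, hc⟩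
    · exact not_joined_of_rho_eq_top hρ hc hv hv' hadj P
    · exact not_joined_of_rho_eq_top hρ hc hv hv' hadj P

end CDSInstance

theorem theorem2 {X Y : ℕ} (G : CDSInstance X Y)
    (hun : ∀ v : CDSInstance.Node X Y, ∃ u, G.unqualified.Adj v u)
    (hpc : G.ComponentsArePathsOrCycles) :
    (∀ r : ℕ, G.rho = (r : ℕ∞) →
      G.IsLinearCapacity (((r : ℝ) - 1) / (2 * (r : ℝ))) ∧
      ∀ p : ℕ, ∀ _ : Fact p.Prime, 2 * r - 2 ≤ p →
        ∃ (LZ : ℕ) (C : LinearScheme (ZMod p) X Y (r - 1) r LZ), C.Feasible G) ∧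
    (G.rho = ⊤ → (∃ u v, G.qualified.Adj u v) → G.IsLinearCapacity (1 / 2)) := by
  refine ⟨fun r hρ => ?_, fun hρ hq => ?_⟩
  · obtain ⟨e, a, b, P, M, he, hM, hMr⟩ := CDSInstance.exists_cover_of_rho_eq hρ
    obtain ⟨d, rfl⟩ : ∃ d, r = d + 1 :=
      Nat.exists_eq_succ_of_ne_zero (hMr ▸ (Finset.card_pos.2 ⟨_, hM.2.1⟩).ne')
    have hach : ∀ p : ℕ, ∀ _ : Fact p.Prime, 2 * (d + 1) - 2 ≤ p →
        ∃ (LZ : ℕ) (C : LinearScheme (ZMod p) X Y d (d + 1) LZ), C.Feasible G := fun p _ hp =>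
      CDSInstance.exists_feasible_of_le_rho hpc (by omega) hρ.ge
    refine ⟨⟨?_, fun B hB => ?_⟩, hach⟩
    · rintro R ⟨K, _, _, L, N, LZ, C, hN, hC, hR⟩
      refine hR.trans ?_
      have h := hM.secret_le hC he
      rw [hMr, Nat.add_sub_cancel] at h
      have h' : (L : ℝ) * (d + 1) ≤ N * d := by exact_mod_cast h
      have hN' : (0 : ℝ) < N := by exact_mod_cast hN
      push_cast
      rw [div_le_div_iff₀ (by positivity) (by positivity)]
      nlinarith
    · obtain ⟨p, hp, hprime⟩ := Nat.exists_infinite_primes (2 * (d + 1) - 2)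
      have : Fact p.Prime := ⟨hprime⟩
      obtain ⟨LZ, C, hC⟩ := hach p this hp
      refine hB ⟨ZMod p, inferInstance, inferInstance, d, d + 1, LZ, C, d.succ_pos, hC, ?_⟩
      push_cast
      rw [add_sub_cancel_right]
  · obtain ⟨u, v, huv⟩ := hq
    refine ⟨?_, fun B hB => ?_⟩
    · rintro R ⟨K, _, _, L, N, LZ, C, hN, hC, hR⟩
      refine hR.trans ?_
      have h' : (L : ℝ) ≤ N := by exact_mod_cast CDSInstance.secret_le_of_adj hC huv
      have hN' : (0 : ℝ) < N := by exact_mod_cast hN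
      rw [div_le_div_iff₀ (by positivity) (by positivity)]
      linarith
    · obtain ⟨p, hp, hprime⟩ := Nat.exists_infinite_primes (X + Y)
      have : Fact p.Prime := ⟨hprime⟩
      obtain ⟨LZ, C, hC⟩ := CDSInstance.exists_feasible_of_rho_eq_top hpc hρ hp
      exact hB ⟨ZMod p, inferInstance, inferInstance, 1, 1, LZ, C, one_pos, hC, by norm_num⟩
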